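/- Let $T,N\ge 1$ be integers and $a>0$; let $B_a$ be the open ball of radius $a$ centred at $0$ in $\mathbb{R}^N$ (Euclidean norm $|\cdot|$, inner product $\langle\cdot|\cdot\rangle$). Assume: (H$_\Phi$) $\phi:B_a\to\mathbb{R}^N$ is a homeomorphism onto $\mathbb{R}^N$ with $\phi(0)=0$ and $\phi=\nabla\Phi$ on $B_a$, where $\Phi:\overline{B}_a\to\mathbb{R}$ is continuous and strictly convex on $\overline{B}_a$, of class $C^1$ on $B_a$, and $\Phi(0)=0$; (H$_F$) $F:\{1,\dots,T\}\times\mathbb{R}^N\to\mathbb{R}$ is continuous, the gradient $\nabla_uF(n,u)$ exists and is continuous on $\{1,\dots,T\}\times\mathbb{R}^N$, and $F(\cdot,0)=0$; (H$_j$) $j:\mathbb{R}^N\times\mathbb{R}^N\to(-\infty,+\infty]$ is proper, convex and lower semicontinuous, with $j(0)=0$ and $0\in\partial j(0)$, where $\partial j$ is the subdifferential in the sense of convex analysis. Let $X_{T+2}$ be the space of functions $u:\{0,\dots,T+1\}\to\mathbb{R}^N$ with norm $\|u\|_{T+2}=(\sum_{m=0}^{T+1}|u(m)|^2)^{1/2}$;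 write $\|u\|_T=(\sum_{m=1}^{T}|u(m)|^2)^{1/2}$, $\Delta u(n-1)=u(n)-u(n-1)$ and $\|\Delta u\|_\infty=\max_{1\le n\le T+1}|\Delta u(n-1)|$. The domain of an extended real valued function is the set where it is finite, and $D(\partial j)=\{z:\partial j(z)\ne\emptyset\}$. On $X_{T+2}$ define $\Psi(u)=\sum_{n=1}^{T+1}\Phi(\Delta u(n-1))$ if $\|\Delta u\|_\infty\le a$ and $\Psi(u)=+\infty$ otherwise, $J(u)=j(u(0),u(T+1))$, $\mathbf{F}(u)=-\sum_{n=1}^{T}F(n,u(n))$ and $\mathcal{E}=\Psi+J+\mathbf{F}$. Let $$\lambda_1=\inf\left\{\frac{\sum_{n=1}^{T+1}|\Delta w(n-1)|^2}{\|w\|_T^2}\;:\; w\in X_{T+2},\ \|\Delta w\|_\infty<a,\ (w(0),w(T+1))\in D(\partial j),\ \|w\|_T\ne 0\right\}.$$ A (PS)-sequence for $\mathcal{E}$ is a sequence $(w_k)$ in $D(\Psi+J)$ such that $\mathcal{E}(w_k)\to c$ for some $c\in\mathbb{R}$ and, for some $\varepsilon_k\to0$, $(\Psi+J)(v)-(\Psi+J)(w_k)+\langle\mathbf{F}'(w_k),v-w_k\rangle\ge-\varepsilon_k\|v-w_k\|_{T+2}$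 for all $v\in D(\Psi+J)$ and all $k$; $\mathcal{E}$ satisfies the (PS)-condition if every (PS)-sequence has a subsequence that converges in $X_{T+2}$. A solution of the potential problem is a $u\in X_{T+2}$ with $\|\Delta u\|_\infty<a$ and $(u(0),u(T+1))\in D(\partial j)$ such that $$-\Delta[\phi(\Delta u(n-1))]=\nabla_uF(n,u(n))\quad(n=1,\dots,T),\qquad (\phi(\Delta u(0)),-\phi(\Delta u(T)))\in\partial j(u(0),u(T+1)),$$ where $\Delta[\phi(\Delta u(n-1))]=\phi(\Delta u(n))-\phi(\Delta u(n-1))$. **Theorem 5.3.** If $\lambda_1>0$, then: (i) every $w\in D(\Psi+J)$ satisfies $|w(m)|\le a\left(\sqrt{\frac{T+1}{T\lambda_1}}+T\right)$ for all $m\in\{0,\dots,T+1\}$; (ii) $\mathcal{E}$ is bounded from below and satisfies the (PS)-condition; (iii) $\mathcal{E}$ attains its infimum over $X_{T+2}$ at some $u\in D(\Psi+J)$, and every minimizer of $\mathcal{E}$ is a solution of the potential problem. -/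

import Mathlib

/-! Discrete singular `φ`-Laplacian systems with a potential structure and a boundary condition
given by the subdifferential of a convex function. -/

namespace PhiLap

open Filter Topology

noncomputable section

/-- `ℝ^N` with the Euclidean norm. -/
abbrev E (N : ℕ) : Type := EuclideanSpace ℝ (Fin N)

/-- The space `X_{T+2}` of functions `u : {0, …, T+1} → ℝ^N`, with the norm
`‖u‖_{T+2} = (∑_{m=0}^{T+1} |u(m)|²)^{1/2}`. -/
abbrev X (T N : ℕ) : Type := PiLp 2 (fun _ : Fin (T + 2) => E N)

variable {T N : ℕ}

/-- Forward differences: the index `i ∈ {0, …, T}` gives `Δu(i) = u(i+1) - u(i)`. -/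
def fwd (u : X T N) (i : Fin (T + 1)) : E N := u i.succ - u i.castSucc

/-- The interior value `u(n)`, `n ∈ {1, …, T}`, where `n` is encoded by `i = n - 1 : Fin T`. -/
def midVal (u : X T N) (i : Fin T) : E N := u i.castSucc.succ

/-- The pair of boundary values `(u(0), u(T+1))`. -/
def bdry (u : X T N) : E N × E N := (u 0, u (Fin.last (T + 1)))

/-- `‖u‖_T² = ∑_{n=1}^{T} |u(n)|²`. -/
def normSqT (u : X T N) : ℝ := ∑ i : Fin T, ‖midVal u i‖ ^ 2

/-- The inner product of `ℝ^N × ℝ^N`. -/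
def pairInner (z w : E N × E N) : ℝ := inner ℝ z.1 w.1 + inner ℝ z.2 w.2

/-- The effective domain of an extended real valued function. -/
def effDom {α : Type*} (f : α → EReal) : Set α := {x | f x < ⊤}

/-- The subdifferential of `j : ℝ^N × ℝ^N → (-∞, +∞]` at `z`. -/
def subdiff (j : E N × E N → EReal) (z : E N × E N) : Set (E N × E N) :=
  {p | ∀ y, j z + ((pairInner p (y - z) : ℝ) : EReal) ≤ j y}

/-- The domain of a set-valued operator. -/
def opDom (γ : E N × E N → Set (E N × E N)) : Set (E N × E N) := {z | (γ z).Nonempty}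

/-- Hypothesis on `φ` and its potential `Φ` (only the values of `φ` on the open ball `B_a` and of
`Φ` on the closed ball matter). -/
structure HypPhi (a : ℝ) (φ : E N → E N) (Φ : E N → ℝ) : Prop where
  homeo : IsHomeomorph ((Metric.ball (0 : E N) a).domRestrict φ)
  map_zero : φ 0 = 0
  grad : ∀ y ∈ Metric.ball (0 : E N) a, HasGradientAt Φ (φ y) y
  contDiff : ContDiffOn ℝ 1 Φ (Metric.ball (0 : E N) a)
  cont : ContinuousOn Φ (Metric.closedBall (0 : E N) a)
  strictConvex : StrictConvexOn ℝ (Metric.closedBall (0 : E N) a) Φ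
  pot_zero : Φ 0 = 0

/-- Hypothesis on `F : {1, …, T} × ℝ^N → ℝ`; the first argument `n` is encoded by
`i = n - 1 : Fin T`. -/
structure HypF (F : Fin T → E N → ℝ) : Prop where
  cont : ∀ i, Continuous (F i)
  diff : ∀ i, Differentiable ℝ (F i)
  grad_cont : ∀ i, Continuous (gradient (F i))
  zero : ∀ i, F i 0 = 0

/-- Hypothesis on `j : ℝ^N × ℝ^N → (-∞, +∞]`: proper, convex, lower semicontinuous, `j(0) = 0`
and `0 ∈ ∂j(0)`. -/
structure HypJ (j : E N × E N → EReal) : Prop where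
  ne_bot : ∀ z, j z ≠ ⊥
  proper : ∃ z, j z ≠ ⊤
  convex : ∀ z w : E N × E N, ∀ t : ℝ, 0 < t → t < 1 →
    j (t • z + (1 - t) • w) ≤ (t : EReal) * j z + ((1 - t : ℝ) : EReal) * j w
  lsc : LowerSemicontinuous j
  zero : j 0 = 0
  zero_mem : 0 ∈ subdiff j 0

/-- The set `𝒦(a, γ)` of all `w` with `‖Δw‖_∞ < a` and `(w(0), w(T+1)) ∈ D(γ)`. -/
def KSet (T : ℕ) (a : ℝ) (γ : E N × E N → Set (E N × E N)) : Set (X T N) :=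
  {w | (∀ i, ‖fwd w i‖ < a) ∧ bdry w ∈ opDom γ}

/-- `λ₁(a, γ)`: the infimum of the quotients `∑_{n=1}^{T+1} |Δw(n-1)|² / ‖w‖_T²` over the
`w ∈ 𝒦(a, γ)` which do not vanish identically on `{1, …, T}`. -/
def lambda1 (T : ℕ) (a : ℝ) (γ : E N × E N → Set (E N × E N)) : ℝ :=
  sInf {r | ∃ w ∈ KSet T a γ, (∃ i, midVal w i ≠ 0) ∧
    r = (∑ i, ‖fwd w i‖ ^ 2) / normSqT w}

open Classical in
/-- `Ψ(u) = ∑_{n=1}^{T+1} Φ(Δu(n-1))` if `‖Δu‖_∞ ≤ a`, and `+∞` otherwise. -/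
def Psi (a : ℝ) (Φ : E N → ℝ) (u : X T N) : EReal :=
  if ∀ i, ‖fwd u i‖ ≤ a then ((∑ i, Φ (fwd u i) : ℝ) : EReal) else ⊤

/-- `J(u) = j(u(0), u(T+1))`. -/
def bigJ (j : E N × E N → EReal) (u : X T N) : EReal := j (bdry u)

/-- `Ψ + J`. -/
def PsiJ (a : ℝ) (Φ : E N → ℝ) (j : E N × E N → EReal) (u : X T N) : EReal :=
  Psi a Φ u + bigJ j u

/-- The smooth part `𝐅(u) = -∑_{n=1}^{T} F(n, u(n))`. -/
def bigF (F : Fin T → E N → ℝ) (u : X T N) : ℝ := -∑ i, F i (midVal u i)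

/-- The energy functional `ℰ = Ψ + J + 𝐅`. -/
def energy (a : ℝ) (Φ : E N → ℝ) (j : E N × E N → EReal) (F : Fin T → E N → ℝ)
    (u : X T N) : EReal :=
  PsiJ a Φ j u + (bigF F u : EReal)

/-- `w` is a (PS)-sequence for `ℰ`. -/
def IsPSSeq (a : ℝ) (Φ : E N → ℝ) (j : E N × E N → EReal) (F : Fin T → E N → ℝ)
    (w : ℕ → X T N) : Prop :=
  (∀ k, w k ∈ effDom (PsiJ (T := T) a Φ j)) ∧
  (∃ c : ℝ, Tendsto (fun k => energy a Φ j F (w k)) atTop (𝓝 (c : EReal))) ∧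
  ∃ ε : ℕ → ℝ, Tendsto ε atTop (𝓝 0) ∧
    ∀ k, ∀ v ∈ effDom (PsiJ (T := T) a Φ j),
      ((-(ε k) * ‖v - w k‖ : ℝ) : EReal) ≤
        PsiJ a Φ j v - PsiJ a Φ j (w k) + ((fderiv ℝ (bigF F) (w k) (v - w k) : ℝ) : EReal)

/-- The (PS)-condition: every (PS)-sequence has a convergent subsequence. -/
def SatisfiesPS (a : ℝ) (Φ : E N → ℝ) (j : E N × E N → EReal) (F : Fin T → E N → ℝ) : Prop :=
  ∀ w : ℕ → X T N, IsPSSeq a Φ j F w →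
    ∃ s : ℕ → ℕ, StrictMono s ∧ ∃ u : X T N, Tendsto (w ∘ s) atTop (𝓝 u)

/-- `u` is a solution of the problem
`-Δ[φ(Δu(n-1))] = ∇_u F(n, u(n))` for `n ∈ {1, …, T}`,
`(φ(Δu(0)), -φ(Δu(T))) ∈ ∂j(u(0), u(T+1))`. -/
def IsSolution (a : ℝ) (φ : E N → E N) (j : E N × E N → EReal) (F : Fin T → E N → ℝ)
    (u : X T N) : Prop :=
  (∀ i, ‖fwd u i‖ < a) ∧
  bdry u ∈ opDom (subdiff j) ∧
  (∀ i : Fin T, -(φ (fwd u i.succ) - φ (fwd u i.castSucc)) = gradient (F i) (midVal u i)) ∧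
  (φ (fwd u 0), -φ (fwd u (Fin.last T))) ∈ subdiff j (bdry u)

end

end PhiLap

namespace PhiLap

open Filter Topology

/-! ### Differences, boundary values and interior values -/

variable {T N : ℕ}

/-! Finite dimension reduces everything to an a priori bound and first-order optimality. The
condition `λ₁ > 0` bounds the interior values of every element of the effective domain, and the
bound on the differences carries this to the end points (`norm_apply_le`). The effective domain then
lies in a compact set, so lower semicontinuity yields a minimizer and Bolzano–Weierstrass the
(PS)-condition.

The delicate point is that a minimizer `u` has no difference on the sphere `|y| = a`, where `φ` is
not defined. Since `φ` is a homeomorphism onto the whole space, it blows up at the sphere; shrinking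
`u` to `(1 - t) • u` would then lower `Φ` faster than the smooth part can grow, while `j` does not
increase (`norm_fwd_lt_of_minimizer`). Once the differences are interior, all small variations are
admissible (`variational_ineq`), and summation by parts separates the equation from the boundary
inclusion. -/

@[simp] lemma fwd_add (u v : X T N) (i : Fin (T + 1)) : fwd (u + v) i = fwd u i + fwd v i := by
  simp only [fwd, PiLp.add_apply]; abel

@[simp] lemma fwd_smul (t : ℝ) (u : X T N) (i : Fin (T + 1)) : fwd (t • u) i = t • fwd u i := by
  simp only [fwd, PiLp.smul_apply, smul_sub]

@[simp] lemma midVal_smul (t : ℝ) (u : X T N) (i : Fin T) : midVal (t • u) i = t • midVal u i :=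
  rfl

@[simp] lemma bdry_add (u v : X T N) : bdry (u + v) = bdry u + bdry v := rfl

@[simp] lemma bdry_smul (t : ℝ) (u : X T N) : bdry (t • u) = t • bdry u := rfl

@[fun_prop] lemma continuous_fwd (i : Fin (T + 1)) : Continuous fun u : X T N => fwd u i := by
  unfold fwd; fun_prop

@[fun_prop] lemma continuous_midVal (i : Fin T) : Continuous fun u : X T N => midVal u i := by
  unfold midVal; fun_prop

@[fun_prop] lemma continuous_bdry : Continuous fun u : X T N => bdry u := by
  unfold bdry; fun_prop

/-- The element of `X T N` with given boundary and interior values. -/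
noncomputable def mkX (b : E N × E N) (m : Fin T → E N) : X T N :=
  WithLp.toLp 2 (Fin.cons b.1 (Fin.snoc m b.2 : Fin (T + 1) → E N) : Fin (T + 2) → E N)

@[simp] lemma bdry_mkX (b : E N × E N) (m : Fin T → E N) : bdry (mkX b m) = b := by
  ext1
  · simp [bdry, mkX]
  · simp [bdry, mkX, ← Fin.succ_last]

@[simp] lemma midVal_mkX (b : E N × E N) (m : Fin T → E N) (i : Fin T) :
    midVal (mkX b m) i = m i := by
  simp [midVal, mkX]

lemma mkX_bdry_midVal (u : X T N) : mkX (bdry u) (midVal u) = u := by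
  ext1 k
  refine Fin.cases ?_ (fun k => ?_) k
  · simp [bdry, mkX]
  · refine Fin.lastCases ?_ (fun k => ?_) k
    · simp [bdry, mkX]
    · simp [midVal, mkX]

lemma continuous_mkX (m : Fin T → E N) : Continuous fun b : E N × E N => (mkX b m : X T N) := by
  refine (PiLp.continuous_toLp 2 _).comp (continuous_pi fun k => ?_)
  refine Fin.cases ?_ (fun k => ?_) k
  · simpa using continuous_fst
  · refine Fin.lastCases ?_ (fun k => ?_) k
    · simpa using continuous_snd
    · simpa using continuous_const

/-- Summation by parts: interior and boundary values of the variation become independent. -/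
lemma sum_inner_fwd (p : Fin (T + 1) → E N) (h : X T N) :
    ∑ i, inner ℝ (p i) (fwd h i) =
      inner ℝ (p (Fin.last T)) (bdry h).2 - inner ℝ (p 0) (bdry h).1 -
        ∑ i : Fin T, inner ℝ (p i.succ - p i.castSucc) (midVal h i) := by
  have h1 : ∑ i, inner ℝ (p i) (h i.succ) =
      ∑ i : Fin T, inner ℝ (p i.castSucc) (midVal h i) + inner ℝ (p (Fin.last T)) (bdry h).2 := by
    rw [Fin.sum_univ_castSucc]; rfl
  have h2 : ∑ i, inner ℝ (p i) (h i.castSucc) =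
      inner ℝ (p 0) (bdry h).1 + ∑ i : Fin T, inner ℝ (p i.succ) (midVal h i) := by
    rw [Fin.sum_univ_succ]; rfl
  simp only [fwd, inner_sub_right, inner_sub_left, Finset.sum_sub_distrib, h1, h2]
  ring

lemma norm_sub_le_of_norm_fwd_le {a : ℝ} {w : X T N} (hw : ∀ i, ‖fwd w i‖ ≤ a) (p k : ℕ)
    (h : p + k < T + 2) : ‖w ⟨p + k, h⟩ - w ⟨p, by omega⟩‖ ≤ k * a := by
  induction k with
  | zero => simp
  | succ k ih =>
    have h1 := ih (by omega)
    have h2 : ‖w ⟨p + (k + 1), h⟩ - w ⟨p + k, by omega⟩‖ ≤ a := hw ⟨p + k, by omega⟩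
    have h3 := norm_sub_le_norm_sub_add_norm_sub (w ⟨p + (k + 1), h⟩) (w ⟨p + k, by omega⟩)
      (w ⟨p, by omega⟩)
    push_cast
    linarith

/-- An interior index is at most `T` steps away from any index in `{0, …, T+1}`. -/
lemma norm_sub_midVal_le {a : ℝ} (ha : 0 ≤ a) {w : X T N} (hw : ∀ i, ‖fwd w i‖ ≤ a)
    (m : Fin (T + 2)) (i : Fin T) : ‖w m - midVal w i‖ ≤ T * a := by
  obtain ⟨m, hm⟩ := m
  obtain ⟨i, hi⟩ := i
  change ‖w ⟨m, hm⟩ - w ⟨i + 1, by omega⟩‖ ≤ _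
  rcases le_total m (i + 1) with h | h
  · obtain ⟨k, hk⟩ := Nat.exists_eq_add_of_le h
    have h1 := norm_sub_le_of_norm_fwd_le hw m k (by omega)
    have h2 : (k : ℝ) ≤ T := by exact_mod_cast (by omega : k ≤ T)
    rw [norm_sub_rev]
    simp only [hk]
    exact h1.trans (by gcongr)
  · obtain ⟨k, rfl⟩ := Nat.exists_eq_add_of_le h
    have h1 := norm_sub_le_of_norm_fwd_le hw (i + 1) k (by omega)
    have h2 : (k : ℝ) ≤ T := by exact_mod_cast (by omega : k ≤ T)
    exact h1.trans (by gcongr)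

/-- The one-sided derivative test behind every optimality and convexity argument below. -/
lemma le_of_hasDerivAt_of_eventually {g : ℝ → ℝ} {c d : ℝ} (hg : HasDerivAt g d 0)
    (h : ∀ᶠ t in 𝓝[>] (0 : ℝ), t * c ≤ g t - g 0) : c ≤ d := by
  have h1 := hg.tendsto_slope_zero_right
  refine ge_of_tendsto h1 ?_
  filter_upwards [h, self_mem_nhdsWithin] with t ht ht0
  have ht0 : 0 < t := ht0
  rw [zero_add, smul_eq_mul, inv_mul_eq_div, le_div_iff₀ ht0]
  linarith

/-! ### The convex function `j` and its subdifferential -/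

lemma HypJ.coe_toReal {j : E N × E N → EReal} (hj : HypJ j) {z : E N × E N} (hz : j z < ⊤) :
    ((j z).toReal : EReal) = j z := EReal.coe_toReal hz.ne (hj.ne_bot z)

lemma HypJ.nonneg {j : E N × E N → EReal} (hj : HypJ j) (z : E N × E N) : 0 ≤ j z := by
  have := hj.zero_mem z
  simpa [hj.zero, pairInner] using this

/-- Convexity of `j` along segments, in real form. -/
lemma HypJ.segment {j : E N × E N → EReal} (hj : HypJ j) {z w : E N × E N} (hz : j z < ⊤)
    (hw : j w < ⊤) {t : ℝ} (h0 : 0 < t) (h1 : t < 1) :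
    j (z + t • (w - z)) < ⊤ ∧
      (j (z + t • (w - z))).toReal ≤ (j z).toReal + t * ((j w).toReal - (j z).toReal) := by
  have h := hj.convex w z t h0 h1
  have he : t • w + (1 - t) • z = z + t • (w - z) := by module
  rw [he, ← hj.coe_toReal hz, ← hj.coe_toReal hw] at h
  norm_cast at h
  have hlt : j (z + t • (w - z)) < ⊤ := h.trans_lt (EReal.coe_lt_top _)
  refine ⟨hlt, ?_⟩
  rw [← hj.coe_toReal hlt] at h
  have := EReal.coe_le_coe_iff.1 h
  linarith

/-- A continuous perturbation of `j` attains its minimum over a nonempty compact set. -/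
lemma HypJ.exists_min {j : E N × E N → EReal} (hj : HypJ j) {α : Type*} [TopologicalSpace α]
    {K : Set α} (hK : IsCompact K) (hne : K.Nonempty) {f : α → ℝ} (hf : ContinuousOn f K)
    {b : α → E N × E N} (hb : Continuous b) :
    ∃ x ∈ K, ∀ y ∈ K, (f x : EReal) + j (b x) ≤ (f y : EReal) + j (b y) := by
  have h1 : LowerSemicontinuousOn (fun x => (f x : EReal)) K :=
    (continuous_coe_real_ereal.comp_continuousOn hf).lowerSemicontinuousOn
  have h2 : LowerSemicontinuousOn (fun x => j (b x)) K :=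
    (hj.lsc.comp hb).lowerSemicontinuousOn K
  exact (h1.add' h2 fun x _ => EReal.continuousAt_add (Or.inl (EReal.coe_ne_top _))
    (Or.inl (EReal.coe_ne_bot _))).exists_isMinOn hne hK

/-- The norm on the product is the maximum norm, whereas subgradients use the Euclidean pairing. -/
lemma sq_norm_le_pairInner (z : E N × E N) : ‖z‖ ^ 2 ≤ pairInner z z := by
  simp only [pairInner, real_inner_self_eq_norm_sq, Prod.norm_def]
  rcases max_choice ‖z.1‖ ‖z.2‖ with h | h <;> rw [h] <;>
    nlinarith [sq_nonneg ‖z.1‖, sq_nonneg ‖z.2‖]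

lemma pairInner_add_smul_self (x y : E N × E N) (t : ℝ) :
    pairInner (x + t • y) (x + t • y) =
      pairInner x x + 2 * t * pairInner x y + t ^ 2 * pairInner y y := by
  simp only [pairInner, Prod.fst_add, Prod.snd_add, Prod.smul_fst, Prod.smul_snd,
    inner_add_left, inner_add_right, real_inner_smul_left, real_inner_smul_right]
  rw [real_inner_comm x.1 y.1, real_inner_comm x.2 y.2]
  ring

lemma pairInner_smul_left (x y : E N × E N) (t : ℝ) :
    pairInner (t • x) y = t * pairInner x y := by
  simp only [pairInner, Prod.smul_fst, Prod.smul_snd, real_inner_smul_left]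
  ring

lemma continuous_pairInner_self : Continuous fun z : E N × E N => pairInner z z := by
  unfold pairInner; fun_prop

/-- The domain of the subdifferential is dense in the effective domain. -/
lemma HypJ.exists_mem_opDom {j : E N × E N → EReal} (hj : HypJ j) {z : E N × E N} (hz : j z < ⊤)
    {δ : ℝ} (hδ : 0 < δ) : ∃ y ∈ opDom (subdiff j), ‖y - z‖ < δ := by
  -- Proximal regularization: minimize `n |y - z|² + j y` near `z`. This `n` makes the penalty on
  -- the sphere of radius `δ` exceed `j z`, so the minimizer lies strictly inside the ball.
  set n : ℝ := (j z).toReal / δ ^ 2 + 1 with hn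
  have hc : 0 ≤ (j z).toReal := EReal.toReal_nonneg (hj.nonneg z)
  have hn0 : 0 < n := by positivity
  have hnδ : (j z).toReal < n * δ ^ 2 := by
    rw [hn, add_mul, div_mul_cancel₀ _ (by positivity)]
    nlinarith [sq_pos_of_pos hδ]
  obtain ⟨y, hyK, hy⟩ := hj.exists_min (isCompact_closedBall z δ)
    ⟨z, Metric.mem_closedBall_self hδ.le⟩
    (f := fun y => n * pairInner (y - z) (y - z))
    ((continuous_const.mul (continuous_pairInner_self.comp
      (continuous_id.sub continuous_const))).continuousOn) continuous_id
  simp only [id] at hy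
  have hyz := hy z (Metric.mem_closedBall_self hδ.le)
  have hytop : j y < ⊤ := by
    by_contra h
    rw [not_lt, top_le_iff] at h
    rw [h, EReal.coe_add_top, ← hj.coe_toReal hz, ← EReal.coe_add] at hyz
    exact EReal.coe_ne_top _ (top_le_iff.1 hyz)
  have hlt : ‖y - z‖ < δ := by
    rw [← hj.coe_toReal hytop, ← hj.coe_toReal hz, ← EReal.coe_add, ← EReal.coe_add,
      EReal.coe_le_coe_iff] at hyz
    have h0 : pairInner (z - z) (z - z) = 0 := by simp [pairInner]
    rw [h0] at hyz
    have h1 : 0 ≤ (j y).toReal := EReal.toReal_nonneg (hj.nonneg y)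
    have h2 := mul_le_mul_of_nonneg_left (sq_norm_le_pairInner (y - z)) hn0.le
    have h3 : n * ‖y - z‖ ^ 2 < n * δ ^ 2 := by linarith
    exact lt_of_pow_lt_pow_left₀ 2 hδ.le (lt_of_mul_lt_mul_left h3 hn0.le)
  -- The subgradient is minus the gradient of the penalty at the minimizer.
  refine ⟨y, ⟨(-(2 * n)) • (y - z), fun w => ?_⟩, hlt⟩
  by_cases hw : j w < ⊤
  swap
  · rw [not_lt, top_le_iff] at hw
    simp [hw]
  have hder : HasDerivAt (fun t : ℝ => n * pairInner ((y - z) + t • (w - y))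
      ((y - z) + t • (w - y))) (2 * n * pairInner (y - z) (w - y)) 0 := by
    simp only [pairInner_add_smul_self]
    have h1 := ((((hasDerivAt_id (0 : ℝ)).const_mul 2).mul_const
      (pairInner (y - z) (w - y))).const_add (pairInner (y - z) (y - z))).add
      (((hasDerivAt_id (0 : ℝ)).pow 2).mul_const (pairInner (w - y) (w - y)))
    refine (h1.const_mul n).congr_deriv ?_
    simp; ring
  have key := le_of_hasDerivAt_of_eventually (c := (j y).toReal - (j w).toReal) hder ?_
  · rw [← hj.coe_toReal hytop, ← hj.coe_toReal hw, ← EReal.coe_add, EReal.coe_le_coe_iff,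
      pairInner_smul_left]
    linarith
  have hnear : ∀ᶠ t in 𝓝[>] (0 : ℝ), y + t • (w - y) ∈ Metric.closedBall z δ := by
    apply nhdsWithin_le_nhds
    have hcont : ContinuousAt (fun t : ℝ => y + t • (w - y)) 0 := by fun_prop
    apply hcont
    simp only [zero_smul, add_zero]
    refine mem_of_superset (Metric.isOpen_ball.mem_nhds ?_) Metric.ball_subset_closedBall
    rwa [Metric.mem_ball, dist_eq_norm]
  filter_upwards [hnear, Ioo_mem_nhdsGT one_pos] with t ht ht01
  obtain ⟨hs1, hs2⟩ := hj.segment hytop hw ht01.1 ht01.2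
  have h1 := hy _ ht
  rw [← hj.coe_toReal hytop, ← hj.coe_toReal hs1, ← EReal.coe_add, ← EReal.coe_add,
    EReal.coe_le_coe_iff] at h1
  have he : y + t • (w - y) - z = (y - z) + t • (w - y) := by abel
  rw [he] at h1
  simp only [zero_smul, add_zero]
  linarith

/-! ### The potential `Φ` and the blow-up of `φ` at the sphere -/

section Potential

variable {a : ℝ} {φ : E N → E N} {Φ : E N → ℝ}

lemma hasDerivAt_comp_line {f : E N → ℝ} {g x : E N} (h : HasGradientAt f g x) (y : E N) :
    HasDerivAt (fun t : ℝ => f (x + t • y)) (inner ℝ g y) 0 := by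
  have h1 : HasDerivAt (fun t : ℝ => x + t • y) y 0 := by
    simpa using ((hasDerivAt_id (0 : ℝ)).smul_const y).const_add x
  have h2 : HasFDerivAt f (InnerProductSpace.toDual ℝ (E N) g) (x + (0 : ℝ) • y) := by
    simpa using h.hasFDerivAt
  have h3 := h2.comp_hasDerivAt (0 : ℝ) h1
  rwa [InnerProductSpace.toDual_apply_apply] at h3

/-- The end point `z` may lie on the sphere: only convexity on the closed ball is needed there. -/
lemma HypPhi.gradient_ineq (hΦ : HypPhi a φ Φ) {x z : E N} (hx : ‖x‖ < a) (hz : ‖z‖ ≤ a) :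
    Φ x + inner ℝ (φ x) (z - x) ≤ Φ z := by
  have hd := (hasDerivAt_comp_line (hΦ.grad x (by simpa using hx)) (z - x)).neg
  have := le_of_hasDerivAt_of_eventually (c := Φ x - Φ z) hd ?_
  · linarith
  filter_upwards [Ioo_mem_nhdsGT one_pos] with t ht
  have h1 := hΦ.strictConvex.convexOn.2 (show x ∈ Metric.closedBall 0 a by simpa using hx.le)
    (show z ∈ Metric.closedBall 0 a by simpa using hz) (sub_nonneg.2 ht.2.le) ht.1.le (by ring)
  have he : (1 - t) • x + t • z = x + t • (z - x) := by module
  rw [he, smul_eq_mul, smul_eq_mul] at h1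
  simp only [Pi.neg_apply, zero_smul, add_zero]
  linarith

lemma HypPhi.nonneg (hΦ : HypPhi a φ Φ) (ha : 0 < a) {z : E N} (hz : ‖z‖ ≤ a) : 0 ≤ Φ z := by
  simpa [hΦ.map_zero, hΦ.pot_zero] using hΦ.gradient_ineq (x := 0) (by simpa using ha) hz

lemma HypPhi.smul_le (hΦ : HypPhi a φ Φ) (ha : 0 < a) {z : E N} (hz : ‖z‖ ≤ a) {t : ℝ}
    (h0 : 0 < t) (h1 : t < 1) : Φ ((1 - t) • z) ≤ Φ z := by
  have h := hΦ.strictConvex.convexOn.2 (show (0 : E N) ∈ Metric.closedBall 0 a by simpa using ha.le)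
    (show z ∈ Metric.closedBall 0 a by simpa using hz) h0.le (sub_nonneg.2 h1.le) (by ring)
  rw [smul_zero, zero_add, hΦ.pot_zero, smul_zero, zero_add, smul_eq_mul] at h
  nlinarith [hΦ.nonneg ha hz]

/-- The homeomorphism `φ` is proper: a bound on `φ z` keeps `z` away from the sphere. -/
lemma HypPhi.exists_radius (hΦ : HypPhi a φ Φ) (ha : 0 < a) {P : ℝ} (hP : 0 ≤ P) :
    ∃ r < a, ∀ z : E N, ‖z‖ < a → ‖φ z‖ ≤ P → ‖z‖ ≤ r := by
  have hK : IsCompact ((↑) '' ((Metric.ball (0 : E N) a).domRestrict φ ⁻¹'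
      Metric.closedBall 0 P) : Set (E N)) :=
    (hΦ.homeo.isClosedEmbedding.isCompact_preimage (isCompact_closedBall _ _)).image
      continuous_subtype_val
  have hmem : ∀ z : E N, ‖z‖ < a → ‖φ z‖ ≤ P → z ∈ ((↑) '' ((Metric.ball (0 : E N) a).domRestrict φ
      ⁻¹' Metric.closedBall 0 P) : Set (E N)) := fun z hz hφ =>
    ⟨⟨z, mem_ball_zero_iff.2 hz⟩, mem_closedBall_zero_iff.2 hφ, rfl⟩
  obtain ⟨x, hxK, hx⟩ := hK.exists_isMaxOn
    ⟨0, hmem 0 (by rwa [norm_zero]) (by rwa [hΦ.map_zero, norm_zero])⟩ continuous_norm.continuousOn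
  have hxa : ‖x‖ < a := by
    obtain ⟨x, -, rfl⟩ := hxK
    exact mem_ball_zero_iff.1 x.2
  exact ⟨‖x‖, hxa, fun z hz hφ => isMaxOn_iff.1 hx z (hmem z hz hφ)⟩

/-- Properness makes `|φ|` large near the sphere, but the component along `y` is needed. With `p = φ
((1 - t) • y)`, the gradient inequality tested at `a p / |p|` gives `(1 - t) ⟨p, y⟩ ≥ a |p| - C`,
where `C` bounds `Φ` on the closed ball. -/
lemma HypPhi.eventually_le_inner (hΦ : HypPhi a φ Φ) (ha : 0 < a) {y : E N} (hy : ‖y‖ = a)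
    {M : ℝ} (hM : 0 ≤ M) : ∀ᶠ t in 𝓝[>] (0 : ℝ), M ≤ inner ℝ (φ ((1 - t) • y)) y := by
  obtain ⟨C, hC⟩ := (isCompact_closedBall (0 : E N) a).bddAbove_image hΦ.cont
  replace hC : ∀ z : E N, ‖z‖ ≤ a → Φ z ≤ C := fun z hz =>
    hC ⟨z, by simpa using hz, rfl⟩
  have hC0 : 0 ≤ C := hΦ.pot_zero ▸ hC 0 (by simpa using ha.le)
  obtain ⟨r, hra, hr⟩ := hΦ.exists_radius ha (P := (M + C) / a) (by positivity)
  have hlim : ∀ᶠ t in 𝓝[>] (0 : ℝ), r < (1 - t) * a := by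
    apply nhdsWithin_le_nhds
    have hcont : ContinuousAt (fun t : ℝ => (1 - t) * a) 0 := by fun_prop
    exact hcont.eventually (lt_mem_nhds (by simpa using hra))
  filter_upwards [hlim, Ioo_mem_nhdsGT one_pos] with t ht ht01
  have hn : ‖(1 - t) • y‖ = (1 - t) * a := by
    rw [norm_smul, hy, Real.norm_of_nonneg (sub_nonneg.2 ht01.2.le)]
  have hna : ‖(1 - t) • y‖ < a := by rw [hn]; nlinarith [ht01.1]
  set p := φ ((1 - t) • y) with hp
  have hpP : (M + C) / a < ‖p‖ := by
    by_contra h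
    have := hr _ hna (not_lt.1 h)
    linarith
  have hp0 : 0 < ‖p‖ := lt_of_le_of_lt (by positivity) hpP
  have hza : ‖(a / ‖p‖) • p‖ = a := by
    rw [norm_smul, Real.norm_of_nonneg (by positivity), div_mul_cancel₀ _ hp0.ne']
  have h1 := hΦ.gradient_ineq hna hza.le
  rw [← hp, inner_sub_right, real_inner_smul_right, real_inner_smul_right,
    real_inner_self_eq_norm_sq] at h1
  have h2 : a / ‖p‖ * ‖p‖ ^ 2 = a * ‖p‖ := by field_simp
  have h3 : M + C < ‖p‖ * a := (div_lt_iff₀ ha).1 hpP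
  have h4 := hC _ hza.le
  have h5 := hΦ.nonneg ha hna.le
  have h6 : M ≤ (1 - t) * inner ℝ p y := by nlinarith
  have h7 : 0 ≤ inner ℝ p y := by
    by_contra hneg
    nlinarith [ht01.2]
  nlinarith [ht01.1]

end Potential

/-! ### The energy and the a priori bound -/

section Energy

variable {a : ℝ} {φ : E N → E N} {Φ : E N → ℝ} {F : Fin T → E N → ℝ} {j : E N × E N → EReal}

lemma mem_effDom_PsiJ (hj : HypJ j) {u : X T N} :
    u ∈ effDom (PsiJ (T := T) a Φ j) ↔ (∀ i, ‖fwd u i‖ ≤ a) ∧ j (bdry u) < ⊤ := by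
  simp only [effDom, Set.mem_ofPred_eq, PsiJ, Psi, bigJ]
  split_ifs with h
  · refine ⟨fun h1 => ⟨h, ?_⟩, fun h1 => EReal.add_lt_top (EReal.coe_ne_top _) h1.2.ne⟩
    by_contra h2
    rw [not_lt, top_le_iff] at h2
    simp [h2] at h1
  · simp [h, EReal.top_add_of_ne_bot (hj.ne_bot _)]

lemma energy_of_norm_fwd_le {u : X T N} (h : ∀ i, ‖fwd u i‖ ≤ a) :
    energy a Φ j F u = ((∑ i, Φ (fwd u i) + bigF F u : ℝ) : EReal) + j (bdry u) := by
  rw [energy, PsiJ, Psi, if_pos h, bigJ, EReal.coe_add, add_right_comm]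

lemma energy_of_notMem {u : X T N} (h : u ∉ effDom (PsiJ (T := T) a Φ j)) :
    energy a Φ j F u = ⊤ := by
  have : PsiJ a Φ j u = ⊤ := by simpa [effDom] using h
  rw [energy, this, EReal.top_add_of_ne_bot (EReal.coe_ne_bot _)]

lemma energy_of_mem (hj : HypJ j) {u : X T N} (h : ∀ i, ‖fwd u i‖ ≤ a) (hb : j (bdry u) < ⊤) :
    energy a Φ j F u =
      ((∑ i, Φ (fwd u i) + bigF F u + (j (bdry u)).toReal : ℝ) : EReal) := by
  rw [energy_of_norm_fwd_le h, EReal.coe_add _ (j (bdry u)).toReal, hj.coe_toReal hb]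

lemma HypF.continuous_bigF (hF : HypF F) : Continuous (bigF F : X T N → ℝ) := by
  unfold bigF
  exact (continuous_finsetSum _ fun i _ => (hF.cont i).comp (continuous_midVal i)).neg

lemma HypF.hasDerivAt_bigF (hF : HypF F) (u h : X T N) :
    HasDerivAt (fun t : ℝ => bigF F (u + t • h))
      (-∑ i, inner ℝ (gradient (F i) (midVal u i)) (midVal h i)) 0 := by
  unfold bigF
  refine (HasDerivAt.fun_sum fun i _ => ?_).neg
  exact hasDerivAt_comp_line ((hF.diff i) (midVal u i)).hasGradientAt (midVal h i)

/-- `λ₁` only sees strict differences and boundary values in `D(∂j)`. Scaling by `1 - t` makes the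
differences strict, density of `D(∂j)` allows the boundary pair to be corrected, and `t → 0`
concludes. -/
lemma lambda1_mul_normSqT_le (hj : HypJ j) (ha : 0 < a) {w : X T N} (hw : ∀ i, ‖fwd w i‖ ≤ a)
    (hb : j (bdry w) < ⊤) : lambda1 T a (subdiff j) * normSqT w ≤ (T + 1) * a ^ 2 := by
  have hK : ∀ v ∈ KSet T a (subdiff j),
      lambda1 T a (subdiff j) * normSqT v ≤ (T + 1) * a ^ 2 := by
    rintro v ⟨hv, hvb⟩
    by_cases h : ∃ i, midVal v i ≠ 0
    swap
    · push Not at h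
      have : normSqT v = 0 := by simp [normSqT, h]
      rw [this, mul_zero]; positivity
    have hpos : 0 < normSqT v := by
      obtain ⟨i, hi⟩ := h
      exact Finset.sum_pos' (fun _ _ => by positivity) ⟨i, Finset.mem_univ _, by positivity⟩
    have h1 : lambda1 T a (subdiff j) ≤ (∑ i, ‖fwd v i‖ ^ 2) / normSqT v := by
      refine csInf_le ⟨0, ?_⟩ ⟨v, ⟨hv, hvb⟩, h, rfl⟩
      rintro _ ⟨x, -, -, rfl⟩
      unfold normSqT
      positivity
    rw [le_div_iff₀ hpos] at h1
    refine h1.trans ?_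
    calc ∑ i, ‖fwd v i‖ ^ 2 ≤ ∑ _i : Fin (T + 1), a ^ 2 := by
          gcongr with i; exact (hv i).le
      _ = (T + 1) * a ^ 2 := by simp
  have hlt : ∀ᶠ t in 𝓝[>] (0 : ℝ),
      lambda1 T a (subdiff j) * ((1 - t) ^ 2 * normSqT w) ≤ (T + 1) * a ^ 2 := by
    filter_upwards [Ioo_mem_nhdsGT one_pos] with t ht
    set v : X T N := (1 - t) • w with hv
    have hvb : j (bdry v) < ⊤ := by
      have := (hj.segment hb (w := 0) (by simp [hj.zero]) ht.1 ht.2).1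
      convert this using 2
      rw [hv, bdry_smul]; module
    have hfw : ∀ i, ‖fwd (mkX (bdry v) (midVal v)) i‖ < a := by
      intro i
      rw [mkX_bdry_midVal, hv, fwd_smul, norm_smul, Real.norm_of_nonneg (sub_nonneg.2 ht.2.le)]
      nlinarith [hw i, norm_nonneg (fwd w i), ht.1, ht.2]
    have hev : ∀ᶠ b in 𝓝 (bdry v), ∀ i, ‖fwd (mkX b (midVal v)) i‖ < a := by
      refine eventually_all.2 fun i => ?_
      exact (((continuous_fwd i).comp (continuous_mkX (midVal v))).norm.tendsto _).eventually
        (gt_mem_nhds (hfw i))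
    obtain ⟨δ, hδ, hball⟩ := Metric.eventually_nhds_iff.1 hev
    obtain ⟨b, hbD, hbδ⟩ := hj.exists_mem_opDom hvb hδ
    have h1 := hK (mkX b (midVal v))
      ⟨hball (by rwa [dist_eq_norm]), by rwa [bdry_mkX]⟩
    -- Only boundary values have moved, so the interior norm is exact and no limit in `δ` is needed.
    have h2 : normSqT (mkX b (midVal v)) = (1 - t) ^ 2 * normSqT w := by
      simp only [normSqT, midVal_mkX, hv, midVal_smul, norm_smul, mul_pow, Real.norm_eq_abs,
        sq_abs, Finset.mul_sum]
    rwa [h2] at h1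
  have hlim : Tendsto (fun t : ℝ => lambda1 T a (subdiff j) * ((1 - t) ^ 2 * normSqT w))
      (𝓝[>] 0) (𝓝 (lambda1 T a (subdiff j) * normSqT w)) := by
    refine tendsto_nhdsWithin_of_tendsto_nhds ?_
    have : Continuous fun t : ℝ => lambda1 T a (subdiff j) * ((1 - t) ^ 2 * normSqT w) := by
      fun_prop
    simpa using this.tendsto 0
  exact le_of_tendsto hlim hlt

/-- A priori bound on the effective domain. -/
lemma norm_apply_le (hT : 1 ≤ T) (ha : 0 < a) (hj : HypJ j)
    (hlam : 0 < lambda1 T a (subdiff j)) {w : X T N} (hw : ∀ i, ‖fwd w i‖ ≤ a)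
    (hb : j (bdry w) < ⊤) (m : Fin (T + 2)) :
    ‖w m‖ ≤ a * (√(((T : ℝ) + 1) / ((T : ℝ) * lambda1 T a (subdiff j))) + (T : ℝ)) := by
  set L := lambda1 T a (subdiff j)
  have hT0 : (0 : ℝ) < T := by exact_mod_cast hT
  have : Nonempty (Fin T) := ⟨⟨0, hT⟩⟩
  -- The smallest interior value is at most the quadratic mean; this produces the `T` under the
  -- root.
  obtain ⟨i, -, hi⟩ := Finset.exists_min_image Finset.univ (fun i : Fin T => ‖midVal w i‖ ^ 2)
    Finset.univ_nonempty
  have h1 : T * ‖midVal w i‖ ^ 2 ≤ normSqT w := by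
    have := Finset.card_nsmul_le_sum Finset.univ _ _ hi
    rwa [Finset.card_univ, Fintype.card_fin, nsmul_eq_mul] at this
  have h2 : L * normSqT w ≤ (T + 1) * a ^ 2 := lambda1_mul_normSqT_le hj ha hw hb
  have h3 : ‖midVal w i‖ ≤ a * √(((T : ℝ) + 1) / (T * L)) := by
    refine (pow_le_pow_iff_left₀ (norm_nonneg _) (by positivity) two_ne_zero).1 ?_
    rw [mul_pow, Real.sq_sqrt (by positivity), mul_div_assoc', le_div_iff₀ (by positivity)]
    nlinarith [mul_le_mul_of_nonneg_left h1 hlam.le]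
  have h4 := norm_sub_midVal_le ha.le hw m i
  have h5 := norm_le_norm_sub_add (w m) (midVal w i)
  linarith

lemma norm_le_of_apply_le {R : ℝ} {u : X T N} (hu : ∀ m, ‖u m‖ ≤ R) :
    ‖u‖ ≤ √((T + 2) * R ^ 2) := by
  refine Real.le_sqrt_of_sq_le ?_
  rw [PiLp.norm_sq_eq_of_L2]
  calc ∑ m, ‖u m‖ ^ 2 ≤ ∑ _m : Fin (T + 2), R ^ 2 := by
        gcongr with m; exact hu m
    _ = (T + 2) * R ^ 2 := by simp

lemma zero_mem_effDom (ha : 0 < a) (hj : HypJ j) : (0 : X T N) ∈ effDom (PsiJ (T := T) a Φ j) := by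
  rw [mem_effDom_PsiJ hj]
  exact ⟨by simp [fwd, ha.le], by simp [bdry, ← Prod.zero_eq_mk, hj.zero]⟩

/-! ### Existence of minimizers and compactness -/

lemma mem_effDom_of_minimizer (ha : 0 < a) (hj : HypJ j) {u : X T N}
    (hu : ∀ v : X T N, energy a Φ j F u ≤ energy a Φ j F v) :
    u ∈ effDom (PsiJ (T := T) a Φ j) := by
  by_contra h
  have h0 := (mem_effDom_PsiJ hj).1 (zero_mem_effDom (T := T) (Φ := Φ) ha hj)
  have h1 := hu 0
  rw [energy_of_notMem h, energy_of_mem hj h0.1 h0.2] at h1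
  exact EReal.coe_ne_top _ (top_le_iff.1 h1)

lemma exists_minimizer (hT : 1 ≤ T) (ha : 0 < a) (hΦ : HypPhi a φ Φ) (hF : HypF F) (hj : HypJ j)
    (hlam : 0 < lambda1 T a (subdiff j)) :
    ∃ u : X T N, u ∈ effDom (PsiJ (T := T) a Φ j) ∧
      ∀ v : X T N, energy a Φ j F u ≤ energy a Φ j F v := by
  set R := a * (√(((T : ℝ) + 1) / ((T : ℝ) * lambda1 T a (subdiff j))) + (T : ℝ)) with hR
  have hR0 : 0 ≤ R := by positivity
  -- On this compact set `Ψ` is finite and continuous; only `j` may still be infinite.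
  let K : Set (X T N) := {u | (∀ i, ‖fwd u i‖ ≤ a) ∧ ∀ m, ‖u m‖ ≤ R}
  have hdom : ∀ u ∈ effDom (PsiJ (T := T) a Φ j), u ∈ K := fun u hu => by
    obtain ⟨h1, h2⟩ := (mem_effDom_PsiJ hj).1 hu
    exact ⟨h1, norm_apply_le hT ha hj hlam h1 h2⟩
  have hclosed : IsClosed K := by
    simp only [K, Set.ofPred_and, Set.ofPred_forall]
    exact (isClosed_iInter fun i => isClosed_le (by fun_prop) continuous_const).inter
      (isClosed_iInter fun m => isClosed_le (by fun_prop) continuous_const)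
  have hbdd : Bornology.IsBounded K := by
    exact isBounded_iff_forall_norm_le.2 ⟨_, fun u hu => norm_le_of_apply_le hu.2⟩
  have hcompact : IsCompact K := Metric.isCompact_of_isClosed_isBounded hclosed hbdd
  have hcont : ContinuousOn (fun u : X T N => ∑ i, Φ (fwd u i) + bigF F u) K := by
    refine ContinuousOn.add (continuousOn_finsetSum _ fun i _ => ?_)
      hF.continuous_bigF.continuousOn
    exact hΦ.cont.comp (continuous_fwd i).continuousOn fun u hu => by simpa using hu.1 i
  obtain ⟨u, huK, hu⟩ := hj.exists_min hcompact ⟨0, hdom 0 (zero_mem_effDom ha hj)⟩ hcont continuous_bdry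
  have hmin : ∀ v : X T N, energy a Φ j F u ≤ energy a Φ j F v := by
    intro v
    by_cases hv : v ∈ effDom (PsiJ (T := T) a Φ j)
    · have hvK := hdom v hv
      rw [energy_of_norm_fwd_le huK.1, energy_of_norm_fwd_le hvK.1]
      exact hu v hvK
    · rw [energy_of_notMem hv]; exact le_top
  exact ⟨u, mem_effDom_of_minimizer ha hj hmin, hmin⟩

lemma satisfiesPS (hT : 1 ≤ T) (ha : 0 < a) (hj : HypJ j)
    (hlam : 0 < lambda1 T a (subdiff j)) : SatisfiesPS a Φ j F := by
  intro w hw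
  have hbdd : Bornology.IsBounded (Set.range w) := by
    have h := fun k => (mem_effDom_PsiJ hj).1 (hw.1 k)
    exact isBounded_iff_forall_norm_le.2 ⟨_, Set.forall_mem_range.2 fun k =>
      norm_le_of_apply_le (norm_apply_le hT ha hj hlam (h k).1 (h k).2)⟩
  obtain ⟨u, -, s, hs, hu⟩ := tendsto_subseq_of_bounded hbdd fun k => Set.mem_range_self k
  exact ⟨s, hs, u, hu⟩

/-! ### Optimality conditions -/

lemma minimizer_le (hj : HypJ j) {u v : X T N} (hu : energy a Φ j F u ≤ energy a Φ j F v)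
    (hu1 : ∀ i, ‖fwd u i‖ ≤ a) (hu2 : j (bdry u) < ⊤)
    (hv1 : ∀ i, ‖fwd v i‖ ≤ a) (hv2 : j (bdry v) < ⊤) :
    ∑ i, Φ (fwd u i) + bigF F u + (j (bdry u)).toReal ≤
      ∑ i, Φ (fwd v i) + bigF F v + (j (bdry v)).toReal := by
  rwa [energy_of_mem hj hu1 hu2, energy_of_mem hj hv1 hv2, EReal.coe_le_coe_iff] at hu

/-- A minimizer of the energy has all its differences in the open ball. -/
lemma norm_fwd_lt_of_minimizer (ha : 0 < a) (hΦ : HypPhi a φ Φ) (hF : HypF F) (hj : HypJ j)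
    {u : X T N} (hu : ∀ v : X T N, energy a Φ j F u ≤ energy a Φ j F v) (i : Fin (T + 1)) :
    ‖fwd u i‖ < a := by
  obtain ⟨h1, h2⟩ := (mem_effDom_PsiJ hj).1 (mem_effDom_of_minimizer ha hj hu)
  by_contra hi
  have hia : ‖fwd u i‖ = a := le_antisymm (h1 i) (not_lt.1 hi)
  have hd := hF.hasDerivAt_bigF u (-u)
  set d := -∑ i, inner ℝ (gradient (F i) (midVal u i)) (midVal (-u) i)
  -- If a difference were on the sphere, shrinking would save at least `t * (max d 0 + 1)` in `Φ`.
  -- Minimality forces the smooth part to grow by as much, yet its slope is `d`. The maximum keeps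
  -- the threshold nonnegative.
  have key : max d 0 + 1 ≤ d := by
    refine le_of_hasDerivAt_of_eventually hd ?_
    filter_upwards [hΦ.eventually_le_inner ha hia (M := max d 0 + 1) (by positivity),
      Ioo_mem_nhdsGT one_pos] with t ht ht01
    have ht1 : 0 ≤ 1 - t := sub_nonneg.2 ht01.2.le
    have he : u + t • (-u) = (1 - t) • u := by module
    rw [he, zero_smul, add_zero]
    have hlt : ∀ k, ‖(1 - t) • fwd u k‖ < a := fun k => by
      rw [norm_smul, Real.norm_of_nonneg ht1]
      nlinarith [h1 k, norm_nonneg (fwd u k), ht01.1, ht01.2]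
    obtain ⟨hb1, hb2⟩ := hj.segment h2 (w := 0) (by simp [hj.zero]) ht01.1 ht01.2
    have hbe : bdry u + t • (0 - bdry u) = bdry ((1 - t) • u) := by
      rw [bdry_smul]; module
    rw [hbe] at hb1 hb2
    have hm := minimizer_le hj (hu ((1 - t) • u)) h1 h2
      (fun k => by rw [fwd_smul]; exact (hlt k).le) hb1
    have hj0 : 0 ≤ (j (bdry u)).toReal := EReal.toReal_nonneg (hj.nonneg _)
    have hjle : (j (bdry ((1 - t) • u))).toReal ≤ (j (bdry u)).toReal := by
      rw [hj.zero, EReal.toReal_zero] at hb2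
      nlinarith [ht01.1]
    have hphi : Φ ((1 - t) • fwd u i) + t * (max d 0 + 1) ≤ Φ (fwd u i) := by
      have h3 := hΦ.gradient_ineq (hlt i) (h1 i)
      have h4 : fwd u i - (1 - t) • fwd u i = t • fwd u i := by module
      rw [h4, real_inner_smul_right] at h3
      nlinarith [ht01.1]
    have hsum : ∑ k, Φ (fwd ((1 - t) • u) k) + t * (max d 0 + 1) ≤ ∑ k, Φ (fwd u k) := by
      rw [← Finset.add_sum_erase _ _ (Finset.mem_univ i),
        ← Finset.add_sum_erase _ (fun k => Φ (fwd u k)) (Finset.mem_univ i)]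
      have h5 : ∑ k ∈ Finset.univ.erase i, Φ (fwd ((1 - t) • u) k) ≤
          ∑ k ∈ Finset.univ.erase i, Φ (fwd u k) := by
        gcongr with k
        rw [fwd_smul]
        exact hΦ.smul_le ha (h1 k) ht01.1 ht01.2
      rw [fwd_smul]
      linarith
    linarith
  linarith [le_max_left d 0]

/-- First order optimality condition for minimizers with differences in the open ball. -/
lemma variational_ineq (hΦ : HypPhi a φ Φ) (hF : HypF F) (hj : HypJ j)
    {u : X T N} (hu : ∀ v : X T N, energy a Φ j F u ≤ energy a Φ j F v)
    (hlt : ∀ i, ‖fwd u i‖ < a) (hb : j (bdry u) < ⊤) {h : X T N}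
    (hh : j (bdry u + bdry h) < ⊤) :
    (j (bdry u)).toReal - (j (bdry u + bdry h)).toReal ≤
      ∑ i, inner ℝ (φ (fwd u i)) (fwd h i) +
        -∑ i, inner ℝ (gradient (F i) (midVal u i)) (midVal h i) := by
  have hd1 : HasDerivAt (fun t : ℝ => ∑ i, Φ (fwd (u + t • h) i))
      (∑ i, inner ℝ (φ (fwd u i)) (fwd h i)) 0 := by
    refine HasDerivAt.fun_sum fun i _ => ?_
    simp only [fwd_add, fwd_smul]
    exact hasDerivAt_comp_line (hΦ.grad _ (mem_ball_zero_iff.2 (hlt i))) (fwd h i)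
  refine le_of_hasDerivAt_of_eventually (hd1.fun_add (hF.hasDerivAt_bigF u h)) ?_
  have hnear : ∀ᶠ t in 𝓝[>] (0 : ℝ), ∀ i, ‖fwd (u + t • h) i‖ < a := by
    apply nhdsWithin_le_nhds
    refine eventually_all.2 fun i => ?_
    have hcont : Continuous fun t : ℝ => ‖fwd (u + t • h) i‖ := by fun_prop
    exact (hcont.tendsto 0).eventually (gt_mem_nhds (by simpa using hlt i))
  filter_upwards [hnear, Ioo_mem_nhdsGT one_pos] with t ht ht01
  obtain ⟨hs1, hs2⟩ := hj.segment hb hh ht01.1 ht01.2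
  have he : bdry u + t • (bdry u + bdry h - bdry u) = bdry (u + t • h) := by
    rw [bdry_add, bdry_smul, add_sub_cancel_left]
  rw [he] at hs1 hs2
  have hm := minimizer_le hj (hu (u + t • h)) (fun i => (hlt i).le) hb (fun i => (ht i).le) hs1
  simp only [zero_smul, add_zero]
  linarith

lemma isSolution_of_minimizer (ha : 0 < a) (hΦ : HypPhi a φ Φ) (hF : HypF F) (hj : HypJ j)
    {u : X T N} (hu : ∀ v : X T N, energy a Φ j F u ≤ energy a Φ j F v) :
    IsSolution a φ j F u := by
  have hlt := norm_fwd_lt_of_minimizer ha hΦ hF hj hu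
  have hb : j (bdry u) < ⊤ := ((mem_effDom_PsiJ hj).1 (mem_effDom_of_minimizer ha hj hu)).2
  -- Boundary variation `b` and interior variation `m` can be chosen independently.
  have key : ∀ (b : E N × E N) (m : Fin T → E N), j (bdry u + b) < ⊤ →
      (j (bdry u)).toReal - (j (bdry u + b)).toReal ≤
        inner ℝ (φ (fwd u (Fin.last T))) b.2 - inner ℝ (φ (fwd u 0)) b.1 -
          ∑ i : Fin T, inner ℝ (φ (fwd u i.succ) - φ (fwd u i.castSucc) +
            gradient (F i) (midVal u i)) (m i) := by
    intro b m hbm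
    have h1 := variational_ineq hΦ hF hj hu hlt hb (h := mkX b m) (by rwa [bdry_mkX])
    rw [sum_inner_fwd (fun i => φ (fwd u i)), bdry_mkX] at h1
    simp only [midVal_mkX] at h1
    simp only [inner_add_left, Finset.sum_add_distrib]
    linarith
  have hsub : (φ (fwd u 0), -φ (fwd u (Fin.last T))) ∈ subdiff j (bdry u) := by
    intro y
    by_cases hy : j y < ⊤
    swap
    · rw [not_lt, top_le_iff] at hy
      simp [hy]
    have h1 := key (y - bdry u) 0 (by rwa [add_sub_cancel])
    rw [add_sub_cancel] at h1
    rw [← hj.coe_toReal hb, ← hj.coe_toReal hy, ← EReal.coe_add, EReal.coe_le_coe_iff, pairInner]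
    simp only [Pi.zero_apply, inner_zero_right, Finset.sum_const_zero, sub_zero] at h1
    simp only [inner_neg_left]
    linarith
  refine ⟨hlt, ⟨_, hsub⟩, fun i => ?_, hsub⟩
  set r := fun i : Fin T => φ (fwd u i.succ) - φ (fwd u i.castSucc) +
    gradient (F i) (midVal u i) with hr
  -- Testing with the residual `r i` at the single index `i` gives `|r i|² ≤ 0`.
  have h1 := key 0 (fun k => if k = i then r i else 0) (by rwa [add_zero])
  simp only [add_zero, sub_self, Prod.fst_zero, Prod.snd_zero, inner_zero_right, zero_sub,
    apply_ite (inner ℝ _), Finset.sum_ite_eq', Finset.mem_univ, if_true] at h1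
  have h2 : inner ℝ (r i) (r i) ≤ 0 := neg_nonneg.1 h1
  have h3 : r i = 0 := inner_self_eq_zero.1 (le_antisymm h2 real_inner_self_nonneg)
  exact neg_eq_of_add_eq_zero_right h3

end Energy

end PhiLap

theorem theorem5p3 (T N : ℕ) (hT : 1 ≤ T) (hN : 1 ≤ N) (a : ℝ) (ha : 0 < a)
    (φ : PhiLap.E N → PhiLap.E N) (Φ : PhiLap.E N → ℝ) (hΦ : PhiLap.HypPhi a φ Φ)
    (F : Fin T → PhiLap.E N → ℝ) (hF : PhiLap.HypF F)
    (j : PhiLap.E N × PhiLap.E N → EReal) (hj : PhiLap.HypJ j)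
    (hlam : 0 < PhiLap.lambda1 T a (PhiLap.subdiff j)) :
    (∀ w : PhiLap.X T N, w ∈ PhiLap.effDom (PhiLap.PsiJ (T := T) a Φ j) → ∀ m : Fin (T + 2),
      ‖w m‖ ≤ a * (√(((T : ℝ) + 1) / ((T : ℝ) * PhiLap.lambda1 T a (PhiLap.subdiff j)))
        + (T : ℝ))) ∧
    ((∃ c : ℝ, ∀ u : PhiLap.X T N, (c : EReal) ≤ PhiLap.energy a Φ j F u) ∧
      PhiLap.SatisfiesPS a Φ j F) ∧
    ((∃ u : PhiLap.X T N, u ∈ PhiLap.effDom (PhiLap.PsiJ (T := T) a Φ j) ∧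
        ∀ v : PhiLap.X T N, PhiLap.energy a Φ j F u ≤ PhiLap.energy a Φ j F v) ∧
      ∀ u : PhiLap.X T N, (∀ v : PhiLap.X T N,
          PhiLap.energy a Φ j F u ≤ PhiLap.energy a Φ j F v) →
        PhiLap.IsSolution a φ j F u) := by
  have hbound := fun (w : PhiLap.X T N) (hw : w ∈ PhiLap.effDom (PhiLap.PsiJ (T := T) a Φ j)) =>
    PhiLap.norm_apply_le hT ha hj hlam ((PhiLap.mem_effDom_PsiJ hj).1 hw).1
      ((PhiLap.mem_effDom_PsiJ hj).1 hw).2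
  obtain ⟨u, hu, hmin⟩ := PhiLap.exists_minimizer hT ha hΦ hF hj hlam
  obtain ⟨h1, h2⟩ := (PhiLap.mem_effDom_PsiJ hj).1 hu
  exact ⟨hbound, ⟨⟨_, fun v => (PhiLap.energy_of_mem hj h1 h2).ge.trans (hmin v)⟩,
    PhiLap.satisfiesPS hT ha hj hlam⟩, ⟨u, hu, hmin⟩,
    fun v hv => PhiLap.isSolution_of_minimizer ha hΦ hF hj hv⟩
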